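/- Let $2\le n\le N$ be integers and let $Z=(z_{j,r})\in\mathbb{C}^{N\times n}$ satisfy $|z_{j,r}|\le 1$ for all $1\le j\le N$, $1\le r\le n$. Let $$\operatorname{Per}(Z)=\sum_{(j_1,\dots,j_n)}\prod_{r=1}^n z_{j_r,r},$$ where the sum runs over all $n$-tuples of pairwise distinct elements of $\{1,\dots,N\}$. Put $\widetilde z_r=\frac1N\sum_{j=1}^N z_{j,r}$ and $$\alpha=\frac1{nN}\sum_{r=1}^n\sum_{j=1}^N|z_{j,r}-\widetilde z_r|^2,\qquad \beta=\frac1n\sum_{r=1}^n|\widetilde z_r|^2,$$ $$\vartheta=\frac{1}{N(N-1)\sqrt{n(n-1)}}\Big(\sum_{\substack{1\le r,s\le n\\ r\ne s}}\Big(\sum_{\substack{1\le u,v\le N\\ u\ne v}}|z_{u,r}-z_{v,r}|\,|z_{u,s}-z_{v,s}|\Big)^2\Big)^{1/2}.$$ Then $$\Big|\frac{(N-n)!}{N!}\operatorname{Per}(Z)-\prod_{r=1}^n\widetilde z_r\Big|\;\le\;\frac{n-1}{2N}\,\vartheta\,\frac{1-\beta^{n/4}}{1-\sqrt\beta}\;\le\;\frac{n-1}{N-1}\,\alpha\,\min\Big\{\frac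 n2,\frac1{1-\sqrt\beta}\Big\}\;\le\;(1+\sqrt\beta)\,\frac{n-1}{N-1}.$$ Here, if $\beta=1$, the quotient $\frac{1-\beta^{n/4}}{1-\sqrt\beta}$ is read as its limit $\frac n2$ and $\frac1{1-\sqrt\beta}$ as $\infty$. -/

import Mathlib

open scoped BigOperators

noncomputable section

namespace RectPerm

variable {N n : ℕ}

/-- The permanent of an `N × n` complex matrix: the sum, over all injective maps `j` from the
column indices to the row indices, of the products `∏ r, Z (j r) r`. -/
def per (Z : Matrix (Fin N) (Fin n) ℂ) : ℂ :=
  ∑ j : Fin n ↪ Fin N, ∏ r : Fin n, Z (j r) r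

/-- The arithmetic mean of the entries of column `r`. -/
def colMean (Z : Matrix (Fin N) (Fin n) ℂ) (r : Fin n) : ℂ :=
  (1 / (N : ℂ)) * ∑ j : Fin N, Z j r

/-- `α`: the mean squared deviation of the entries from their column means. -/
def alpha (Z : Matrix (Fin N) (Fin n) ℂ) : ℝ :=
  (1 / ((n : ℝ) * (N : ℝ))) * ∑ r : Fin n, ∑ j : Fin N, ‖Z j r - colMean Z r‖ ^ 2

/-- `β`: the mean of the squared absolute values of the column means. -/
def beta (Z : Matrix (Fin N) (Fin n) ℂ) : ℝ :=
  (1 / (n : ℝ)) * ∑ r : Fin n, ‖colMean Z r‖ ^ 2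

/-- `ϑ`: both sums run over ordered pairs of distinct indices, the outer one over pairs of
columns, the inner one over pairs of rows. -/
def theta (Z : Matrix (Fin N) (Fin n) ℂ) : ℝ :=
  (1 / ((N : ℝ) * ((N : ℝ) - 1) * √((n : ℝ) * ((n : ℝ) - 1)))) *
    √(∑ p : Fin n × Fin n with p.1 ≠ p.2,
        (∑ q : Fin N × Fin N with q.1 ≠ q.2,
          ‖Z q.1 p.1 - Z q.2 p.1‖ * ‖Z q.1 p.2 - Z q.2 p.2‖) ^ 2)

/-- `(1 - β ^ (n / 4)) / (1 - √β)`, with the indeterminate value at `β = 1` read as its limit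
`n / 2`. -/
def geomQuot (n : ℕ) (β : ℝ) : ℝ :=
  if β = 1 then (n : ℝ) / 2 else (1 - β ^ ((n : ℝ) / 4)) / (1 - √β)

/-- `min {n / 2, 1 / (1 - √β)}`, with `1 / 0 = ∞`, so that the value at `β = 1` is `n / 2`. -/
def minFactor (n : ℕ) (β : ℝ) : ℝ :=
  if β = 1 then (n : ℝ) / 2 else min ((n : ℝ) / 2) (1 / (1 - √β))

end RectPerm

end

/-! The normalised permanent is the average over row permutations `σ` of a product of entries.
Adjoining a column `s` to a set `A` multiplies this average by the mean of column `s`, up to an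
error from row collisions. Swapping two rows symmetrises that error into `-1/(2N)` times a sum over
`r ∈ A` of averages of (difference in column `r`) · (difference in column `s`) · (remaining entries)
(`two_mul_card_mul_sum_perm_prod_insert`).

Since entries have norm at most 1, telescoping over the columns bounds the total error by pair terms
weighted with products of later column means. The permanent does not depend on the column order, so
this bound may be averaged over all orders. Cauchy–Schwarz then separates the pair terms, which give
`ϑ`, from the products of means, which Maclaurin's inequality bounds by powers of `√β`. Maclaurin is
the same insertion identity with equal real columns, where the error has a sign. What remains is a
weighted geometric sum.

The second inequality combines Cauchy–Schwarz for `ϑ` with Bernoulli for the quotient; the third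
uses `α ≤ 1 - β = (1 - √β)(1 + √β)`. -/

namespace RectPerm

open Finset

/-! ### Sums over permutations -/

section PermSums

variable {ι κ K : Type*} [Fintype ι] [DecidableEq ι]

theorem sum_perm_mul_right {M : Type*} [AddCommMonoid M] (τ : Equiv.Perm ι)
    (g : Equiv.Perm ι → M) : ∑ σ : Equiv.Perm ι, g (σ * τ) = ∑ σ : Equiv.Perm ι, g σ :=
  _root_.Equiv.sum_comp (Equiv.mulRight τ) g

/-- Expand `∑ i, z i s` along `σ`. A row index outside `f(A)` can be exchanged with `f s` by a
transposition, so it contributes exactly the product over `insert s A`; only the collisions `i = f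
r` with `r ∈ A` leave a defect. -/
theorem sum_perm_prod_insert [DecidableEq κ] [CommRing K] (f : κ ↪ ι) (z : ι → κ → K)
    (A : Finset κ) {s : κ} (hs : s ∉ A) :
    (Fintype.card ι : K) * ∑ σ : Equiv.Perm ι, ∏ r ∈ insert s A, z (σ (f r)) r
        - (∑ i, z i s) * ∑ σ : Equiv.Perm ι, ∏ r ∈ A, z (σ (f r)) r
      = ∑ r ∈ A, ∑ σ : Equiv.Perm ι, z (σ (f r)) r * (z (σ (f s)) s - z (σ (f r)) s)
          * ∏ q ∈ A.erase r, z (σ (f q)) q := by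
  set P : K := ∑ σ : Equiv.Perm ι, ∏ r ∈ insert s A, z (σ (f r)) r with hP
  have hP' : P = ∑ σ : Equiv.Perm ι, z (σ (f s)) s * ∏ r ∈ A, z (σ (f r)) r := by
    simp only [hP, prod_insert hs]
  let Q : ι → K := fun i => ∑ σ : Equiv.Perm ι, z (σ i) s * ∏ r ∈ A, z (σ (f r)) r
  have h1 : (∑ i, z i s) * ∑ σ : Equiv.Perm ι, ∏ r ∈ A, z (σ (f r)) r = ∑ i, Q i := by
    rw [sum_comm, mul_sum]
    refine sum_congr rfl fun σ _ => ?_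
    rw [← sum_mul, Equiv.sum_comp σ (fun i => z i s)]
  have h2 : ∀ i ∉ A.map f, Q i = P := by
    intro i hi
    rw [hP', ← sum_perm_mul_right (Equiv.swap i (f s))]
    refine sum_congr rfl fun σ _ => ?_
    congr 1
    · simp
    · refine prod_congr rfl fun r hr => ?_
      have ha : f r ≠ i := fun h => hi (mem_map.2 ⟨r, hr, h⟩)
      have hb : f r ≠ f s := fun h => hs (f.injective h ▸ hr)
      simp [Equiv.swap_apply_of_ne_of_ne ha hb]
  have h3 : ∑ i, (P - Q i) = ∑ r ∈ A, (P - Q (f r)) := by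
    rw [← sum_map A f (fun i => P - Q i)]
    exact (sum_subset (subset_univ _) fun i _ hi => by rw [h2 i hi, sub_self]).symm
  have h4 : ∑ i, (P - Q i) = (Fintype.card ι : K) * P - ∑ i, Q i := by
    simp [sum_sub_distrib]
  rw [h1, ← h4, h3]
  refine sum_congr rfl fun r hr => ?_
  rw [hP', ← sum_sub_distrib]
  refine sum_congr rfl fun σ _ => ?_
  rw [← mul_prod_erase A (fun q => z (σ (f q)) q) hr]
  ring

/-- Reindexing by the transposition of `f r` and `f s` fixes the remaining product; averaging the
two forms turns the defect into a product of differences. -/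
theorem two_mul_sum_perm_mul_sub [DecidableEq κ] [CommRing K] (f : κ ↪ ι) (z : ι → κ → K)
    (A : Finset κ) {r s : κ} (hs : s ∉ A) :
    2 * ∑ σ : Equiv.Perm ι, z (σ (f r)) r * (z (σ (f s)) s - z (σ (f r)) s)
          * ∏ q ∈ A.erase r, z (σ (f q)) q
      = -∑ σ : Equiv.Perm ι, (z (σ (f r)) r - z (σ (f s)) r) * (z (σ (f r)) s - z (σ (f s)) s)
          * ∏ q ∈ A.erase r, z (σ (f q)) q := by
  have h : ∑ σ : Equiv.Perm ι, z (σ (f r)) r * (z (σ (f s)) s - z (σ (f r)) s)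
          * ∏ q ∈ A.erase r, z (σ (f q)) q
      = ∑ σ : Equiv.Perm ι, z (σ (f s)) r * (z (σ (f r)) s - z (σ (f s)) s)
          * ∏ q ∈ A.erase r, z (σ (f q)) q := by
    rw [← sum_perm_mul_right (Equiv.swap (f r) (f s))]
    refine sum_congr rfl fun σ _ => ?_
    congr 1
    · simp
    · refine prod_congr rfl fun q hq => ?_
      have ha : f q ≠ f r := fun h => (mem_erase.1 hq).1 (f.injective h)
      have hb : f q ≠ f s := fun h => hs (f.injective h ▸ (mem_erase.1 hq).2)
      simp [Equiv.swap_apply_of_ne_of_ne ha hb]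
  rw [two_mul]
  nth_rewrite 2 [h]
  rw [← sum_add_distrib, ← sum_neg_distrib]
  refine sum_congr rfl fun σ _ => ?_
  ring

theorem two_mul_card_mul_sum_perm_prod_insert [DecidableEq κ] [CommRing K] (f : κ ↪ ι)
    (z : ι → κ → K) (A : Finset κ) {s : κ} (hs : s ∉ A) :
    2 * ((Fintype.card ι : K) * ∑ σ : Equiv.Perm ι, ∏ r ∈ insert s A, z (σ (f r)) r
        - (∑ i, z i s) * ∑ σ : Equiv.Perm ι, ∏ r ∈ A, z (σ (f r)) r)
      = -∑ r ∈ A, ∑ σ : Equiv.Perm ι,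
          (z (σ (f r)) r - z (σ (f s)) r) * (z (σ (f r)) s - z (σ (f s)) s)
            * ∏ q ∈ A.erase r, z (σ (f q)) q := by
  rw [sum_perm_prod_insert f z A hs, mul_sum, ← sum_neg_distrib]
  exact sum_congr rfl fun r _ => two_mul_sum_perm_mul_sub f z A hs

/-- The average over all permutations of a product of values of a nonnegative function at distinct
points is at most the corresponding power of the mean (Maclaurin's inequality). -/
theorem sum_perm_prod_le [Nonempty ι] (x : ι → ℝ) (hx : ∀ i, 0 ≤ x i) (A : Finset ι) :
    ∑ σ : Equiv.Perm ι, ∏ r ∈ A, x (σ r)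
      ≤ ((Fintype.card ι).factorial : ℝ) * ((∑ i, x i) / Fintype.card ι) ^ A.card := by
  have hN : (0 : ℝ) < Fintype.card ι := by exact_mod_cast Fintype.card_pos
  induction A using Finset.induction_on with
  | empty => simp [Fintype.card_perm]
  | insert s A hs ih =>
    -- With all columns equal, the defect is minus a sum of squares times nonnegative factors.
    have h := two_mul_card_mul_sum_perm_prod_insert (Function.Embedding.refl ι)
      (fun i _ => x i) A hs
    simp only [Function.Embedding.refl_apply] at h
    have h0 : 0 ≤ ∑ r ∈ A, ∑ σ : Equiv.Perm ι, (x (σ r) - x (σ s)) * (x (σ r) - x (σ s))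
        * ∏ q ∈ A.erase r, x (σ q) :=
      sum_nonneg fun r _ => sum_nonneg fun σ _ =>
        mul_nonneg (mul_self_nonneg _) (prod_nonneg fun q _ => hx _)
    have hm : 0 ≤ (∑ i, x i) / Fintype.card ι := div_nonneg (sum_nonneg fun i _ => hx i) hN.le
    have h1 : ∑ σ : Equiv.Perm ι, ∏ r ∈ insert s A, x (σ r)
        ≤ (∑ i, x i) / Fintype.card ι * ∑ σ : Equiv.Perm ι, ∏ r ∈ A, x (σ r) := by
      rw [div_mul_eq_mul_div, le_div_iff₀ hN]
      linarith
    refine h1.trans ((mul_le_mul_of_nonneg_left ih hm).trans_eq ?_)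
    rw [card_insert_of_notMem hs]
    ring

/-- Permutations act transitively on embeddings, so the inner sum does not depend on `f`; sum over
all embeddings and exchange. -/
theorem card_mul_sum_perm_comp_embedding [Fintype κ] [CommRing K] (f : κ ↪ ι) (g : (κ ↪ ι) → K) :
    (Fintype.card (κ ↪ ι) : K) * ∑ σ : Equiv.Perm ι, g (f.trans σ.toEmbedding)
      = ((Fintype.card ι).factorial : K) * ∑ j, g j := by
  have h1 : ∀ j : κ ↪ ι, ∑ σ : Equiv.Perm ι, g (j.trans σ.toEmbedding)
      = ∑ σ : Equiv.Perm ι, g (f.trans σ.toEmbedding) := by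
    intro j
    obtain ⟨τ, hτ⟩ := Equiv.Perm.exists_extending_pair f j f.injective j.injective
    obtain rfl : f.trans τ.toEmbedding = j := Function.Embedding.ext hτ
    exact sum_perm_mul_right τ (fun σ => g (f.trans σ.toEmbedding))
  have h2 : ∑ j : κ ↪ ι, ∑ σ : Equiv.Perm ι, g (j.trans σ.toEmbedding)
      = (Fintype.card (κ ↪ ι) : K) * ∑ σ : Equiv.Perm ι, g (f.trans σ.toEmbedding) := by
    simp [h1]
  rw [← h2, sum_comm]
  have h3 : ∀ σ : Equiv.Perm ι, ∑ j : κ ↪ ι, g (j.trans σ.toEmbedding) = ∑ j, g j := fun σ =>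
    (Equiv.embeddingCongr (Equiv.refl κ) σ).sum_comp g
  simp [h3, Fintype.card_perm]

theorem card_mul_sum_perm_pair [CommRing K] {a b : ι} (hab : a ≠ b) (g : ι → ι → K) :
    ((Fintype.card ι : K) * (Fintype.card ι - 1)) * ∑ σ : Equiv.Perm ι, g (σ a) (σ b)
      = ((Fintype.card ι).factorial : K) * ∑ q : ι × ι with q.1 ≠ q.2, g q.1 q.2 := by
  have h1 : ∀ q : ι × ι, q.1 ≠ q.2 → ∑ σ : Equiv.Perm ι, g (σ q.1) (σ q.2)
      = ∑ σ : Equiv.Perm ι, g (σ a) (σ b) := by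
    rintro ⟨u, v⟩ huv
    obtain ⟨τ, h1, h2⟩ : ∃ τ : Equiv.Perm ι, τ a = u ∧ τ b = v := by
      -- The first swap sends `a` to `u`; the second moves the image of `b` to `v` and leaves `u`
      -- alone.
      refine ⟨Equiv.swap (Equiv.swap a u b) v * Equiv.swap a u, ?_, ?_⟩
      · have : u ≠ Equiv.swap a u b := by
          intro h
          have := congrArg (Equiv.swap a u) h
          simp at this
          exact hab this
        simp [Equiv.swap_apply_of_ne_of_ne this huv]
      · simp
    subst h1 h2
    exact sum_perm_mul_right τ (fun σ => g (σ a) (σ b))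
  have hc : ((univ.filter fun q : ι × ι => q.1 ≠ q.2).card : K)
      = (Fintype.card ι : K) * (Fintype.card ι - 1) := by
    have h : (univ.filter fun q : ι × ι => q.1 ≠ q.2) = (univ : Finset ι).offDiag := by
      ext; simp
    rw [h, offDiag_card, card_univ, Nat.cast_sub (Nat.le_mul_self _)]
    push_cast; ring
  have h2 : ∑ q : ι × ι with q.1 ≠ q.2, ∑ σ : Equiv.Perm ι, g (σ q.1) (σ q.2)
      = ((Fintype.card ι : K) * (Fintype.card ι - 1)) * ∑ σ : Equiv.Perm ι, g (σ a) (σ b) := by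
    rw [sum_congr rfl fun q hq => h1 q (mem_filter.1 hq).2, sum_const, nsmul_eq_mul, hc]
  rw [← h2, sum_comm]
  have h3 : ∀ σ : Equiv.Perm ι, ∑ q : ι × ι with q.1 ≠ q.2, g (σ q.1) (σ q.2)
      = ∑ q : ι × ι with q.1 ≠ q.2, g q.1 q.2 := by
    intro σ
    simp only [sum_filter]
    rw [← (Equiv.prodCongr σ σ).sum_comp (fun q : ι × ι => if q.1 ≠ q.2 then g q.1 q.2 else 0)]
    simp
  simp [h3, Fintype.card_perm]

end PermSums

/-! ### Telescoping over columns, and Cauchy–Schwarz over permutations -/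

section Bounds

variable {ι κ : Type*} [Fintype ι] [DecidableEq ι]

theorem norm_sum_perm_pair_mul_prod_le [DecidableEq κ] (f : κ ↪ ι) (z : ι → κ → ℂ)
    (hz : ∀ i r, ‖z i r‖ ≤ 1) (B : Finset κ) {r s : κ} (hrs : r ≠ s)
    (hN : 2 ≤ Fintype.card ι) :
    ‖∑ σ : Equiv.Perm ι, (z (σ (f r)) r - z (σ (f s)) r) * (z (σ (f r)) s - z (σ (f s)) s)
        * ∏ q ∈ B, z (σ (f q)) q‖
      ≤ ((Fintype.card ι).factorial : ℝ) * ((∑ q : ι × ι with q.1 ≠ q.2,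
          ‖z q.1 r - z q.2 r‖ * ‖z q.1 s - z q.2 s‖)
          / ((Fintype.card ι : ℝ) * (Fintype.card ι - 1))) := by
  have hN' : (2 : ℝ) ≤ Fintype.card ι := by exact_mod_cast hN
  have hpos : (0 : ℝ) < (Fintype.card ι : ℝ) * (Fintype.card ι - 1) :=
    mul_pos (by linarith) (by linarith)
  have h := card_mul_sum_perm_pair (f.injective.ne hrs)
    (fun u v => ‖z u r - z v r‖ * ‖z u s - z v s‖)
  rw [← mul_div_assoc, ← h, mul_div_cancel_left₀ _ hpos.ne']
  refine (norm_sum_le _ _).trans (sum_le_sum fun σ _ => ?_)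
  rw [norm_mul, norm_mul, norm_prod]
  exact mul_le_of_le_one_right (by positivity)
    (prod_le_one (fun _ _ => norm_nonneg _) fun _ _ => hz _ _)

theorem norm_permMean_insert_sub_le [DecidableEq κ] (f : κ ↪ ι) (z : ι → κ → ℂ)
    (hz : ∀ i r, ‖z i r‖ ≤ 1) (A : Finset κ) {s : κ} (hs : s ∉ A) (hN : 2 ≤ Fintype.card ι) :
    ‖(∑ σ : Equiv.Perm ι, ∏ r ∈ insert s A, z (σ (f r)) r) / ((Fintype.card ι).factorial : ℂ)
        - (∑ i, z i s) / (Fintype.card ι : ℂ)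
          * ((∑ σ : Equiv.Perm ι, ∏ r ∈ A, z (σ (f r)) r) / ((Fintype.card ι).factorial : ℂ))‖
      ≤ ∑ r ∈ A, (∑ q : ι × ι with q.1 ≠ q.2, ‖z q.1 r - z q.2 r‖ * ‖z q.1 s - z q.2 s‖)
          / ((Fintype.card ι : ℝ) * (Fintype.card ι - 1)) / (2 * (Fintype.card ι : ℝ)) := by
  have hc : (Fintype.card ι : ℂ) ≠ 0 := by
    have : Fintype.card ι ≠ 0 := by omega
    exact_mod_cast this
  have hc' : (0 : ℝ) < Fintype.card ι := by
    have : 0 < Fintype.card ι := by omega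
    exact_mod_cast this
  have hf : ((Fintype.card ι).factorial : ℂ) ≠ 0 := by
    exact_mod_cast (Nat.factorial_pos _).ne'
  have hf' : (0 : ℝ) < ((Fintype.card ι).factorial : ℝ) := by
    exact_mod_cast Nat.factorial_pos _
  have h := two_mul_card_mul_sum_perm_prod_insert f z A hs
  set P := ∑ σ : Equiv.Perm ι, ∏ r ∈ insert s A, z (σ (f r)) r
  set Q := ∑ σ : Equiv.Perm ι, ∏ r ∈ A, z (σ (f r)) r
  have h1 : P / ((Fintype.card ι).factorial : ℂ) - (∑ i, z i s) / (Fintype.card ι : ℂ)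
        * (Q / ((Fintype.card ι).factorial : ℂ))
      = (2 * ((Fintype.card ι : ℂ) * P - (∑ i, z i s) * Q))
        / (((Fintype.card ι).factorial : ℂ) * (2 * (Fintype.card ι : ℂ))) := by
    field_simp
  rw [h1, h, norm_div, norm_neg, norm_mul, norm_mul, Complex.norm_natCast, Complex.norm_natCast,
    Complex.norm_ofNat, div_le_iff₀ (by positivity)]
  refine (norm_sum_le _ _).trans ?_
  rw [sum_mul]
  refine sum_le_sum fun r hr => ?_
  refine (norm_sum_perm_pair_mul_prod_le f z hz (A.erase r)
    (ne_of_mem_of_not_mem hr hs) hN).trans_eq ?_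
  field_simp

/-- Adjoining a new largest column adds one error term with empty tail product and multiplies every
earlier error by the norm of the new column's mean. -/
theorem norm_permMean_sub_prod_le [LinearOrder κ] (f : κ ↪ ι) (z : ι → κ → ℂ)
    (hz : ∀ i r, ‖z i r‖ ≤ 1) (A : Finset κ) (hN : 2 ≤ Fintype.card ι) :
    ‖(∑ σ : Equiv.Perm ι, ∏ r ∈ A, z (σ (f r)) r) / ((Fintype.card ι).factorial : ℂ)
        - ∏ r ∈ A, (∑ i, z i r) / (Fintype.card ι : ℂ)‖
      ≤ ∑ t ∈ A, (∑ r ∈ A with r < t,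
          (∑ q : ι × ι with q.1 ≠ q.2, ‖z q.1 r - z q.2 r‖ * ‖z q.1 t - z q.2 t‖)
          / ((Fintype.card ι : ℝ) * (Fintype.card ι - 1)) / (2 * (Fintype.card ι : ℝ)))
          * ∏ q ∈ A with t < q, ‖(∑ i, z i q) / (Fintype.card ι : ℂ)‖ := by
  induction A using Finset.induction_on_max with
  | empty =>
    have hf : ((Fintype.card ι).factorial : ℂ) ≠ 0 := by
      exact_mod_cast (Nat.factorial_pos _).ne'
    simp [Fintype.card_perm, hf]
  | insert s A hmax ih =>
    have hs : s ∉ A := fun h => lt_irrefl _ (hmax s h)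
    have h1 := norm_permMean_insert_sub_le f z hz A hs hN
    rw [sum_insert hs]
    have e1 : (insert s A).filter (· < s) = A := by
      rw [filter_insert, if_neg (lt_irrefl s)]
      exact filter_true_of_mem hmax
    have e2 : (insert s A).filter (s < ·) = ∅ := by
      rw [filter_insert, if_neg (lt_irrefl s)]
      exact filter_false_of_mem fun x hx => (hmax x hx).not_gt
    rw [e1, e2, prod_empty, mul_one]
    have e3 : ∀ t ∈ A, (insert s A).filter (· < t) = A.filter (· < t) := fun t ht => by
      rw [filter_insert, if_neg (hmax t ht).not_gt]
    have e4 : ∀ t ∈ A, ∏ q ∈ insert s A with t < q, ‖(∑ i, z i q) / (Fintype.card ι : ℂ)‖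
        = ‖(∑ i, z i s) / (Fintype.card ι : ℂ)‖
          * ∏ q ∈ A with t < q, ‖(∑ i, z i q) / (Fintype.card ι : ℂ)‖ := fun t ht => by
      rw [filter_insert, if_pos (hmax t ht), prod_insert fun h => hs (mem_filter.1 h).1]
    have e5 : ∑ t ∈ A, (∑ r ∈ insert s A with r < t,
          (∑ q : ι × ι with q.1 ≠ q.2, ‖z q.1 r - z q.2 r‖ * ‖z q.1 t - z q.2 t‖)
          / ((Fintype.card ι : ℝ) * (Fintype.card ι - 1)) / (2 * (Fintype.card ι : ℝ)))
          * ∏ q ∈ insert s A with t < q, ‖(∑ i, z i q) / (Fintype.card ι : ℂ)‖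
        = ‖(∑ i, z i s) / (Fintype.card ι : ℂ)‖ * ∑ t ∈ A, (∑ r ∈ A with r < t,
          (∑ q : ι × ι with q.1 ≠ q.2, ‖z q.1 r - z q.2 r‖ * ‖z q.1 t - z q.2 t‖)
          / ((Fintype.card ι : ℝ) * (Fintype.card ι - 1)) / (2 * (Fintype.card ι : ℝ)))
          * ∏ q ∈ A with t < q, ‖(∑ i, z i q) / (Fintype.card ι : ℂ)‖ := by
      rw [mul_sum]
      refine sum_congr rfl fun t ht => ?_
      rw [e3 t ht, e4 t ht]
      ring
    rw [e5, prod_insert hs]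
    have h2 := mul_le_mul_of_nonneg_left ih (norm_nonneg ((∑ i, z i s) / (Fintype.card ι : ℂ)))
    rw [← norm_mul] at h2
    refine le_trans ?_ (add_le_add h1 h2)
    refine le_trans (le_of_eq ?_) (norm_add_le _ _)
    congr 1
    ring

/-- Cauchy–Schwarz over `τ`; the pair factor is then averaged exactly and the product factor by
Maclaurin applied to `x ^ 2`. -/
theorem sum_perm_mul_prod_le {a b : ι} (hab : a ≠ b) (D : ι → ι → ℝ) (x : ι → ℝ)
    (B : Finset ι) :
    ∑ τ : Equiv.Perm ι, D (τ a) (τ b) * ∏ q ∈ B, x (τ q)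
      ≤ ((Fintype.card ι).factorial : ℝ)
        * (√((∑ q : ι × ι with q.1 ≠ q.2, D q.1 q.2 ^ 2)
              / ((Fintype.card ι : ℝ) * (Fintype.card ι - 1)))
          * √((∑ i, x i ^ 2) / Fintype.card ι) ^ B.card) := by
  have : Nonempty ι := ⟨a⟩
  have hN' : (1 : ℝ) < Fintype.card ι := by
    exact_mod_cast Fintype.one_lt_card_iff.2 ⟨a, b, hab⟩
  have hpos : (0 : ℝ) < (Fintype.card ι : ℝ) * (Fintype.card ι - 1) :=
    mul_pos (by linarith) (by linarith)
  have h1 : ∑ τ : Equiv.Perm ι, D (τ a) (τ b) ^ 2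
      = ((Fintype.card ι).factorial : ℝ) * ((∑ q : ι × ι with q.1 ≠ q.2, D q.1 q.2 ^ 2)
              / ((Fintype.card ι : ℝ) * (Fintype.card ι - 1))) := by
    rw [← mul_div_assoc, ← card_mul_sum_perm_pair hab (fun u v => D u v ^ 2),
      mul_div_cancel_left₀ _ hpos.ne']
  have h2 : ∑ τ : Equiv.Perm ι, (∏ q ∈ B, x (τ q)) ^ 2
      ≤ ((Fintype.card ι).factorial : ℝ) * ((∑ i, x i ^ 2) / Fintype.card ι) ^ B.card := by
    simp only [← prod_pow]
    exact sum_perm_prod_le (fun i => x i ^ 2) (fun i => sq_nonneg _) B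
  refine (Real.sum_mul_le_sqrt_mul_sqrt _ _ _).trans ?_
  refine (mul_le_mul_of_nonneg_left (Real.sqrt_le_sqrt h2) (Real.sqrt_nonneg _)).trans_eq ?_
  have hm : 0 ≤ (∑ i, x i ^ 2) / Fintype.card ι := by positivity
  have hpow : √(((∑ i, x i ^ 2) / Fintype.card ι) ^ B.card)
      = √((∑ i, x i ^ 2) / Fintype.card ι) ^ B.card := by
    rw [Real.sqrt_eq_iff_mul_self_eq (by positivity) (by positivity), ← mul_pow,
      Real.mul_self_sqrt hm]
  rw [h1, Real.sqrt_mul (by positivity), Real.sqrt_mul (by positivity), hpow,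
    mul_mul_mul_comm, Real.mul_self_sqrt (by positivity)]

end Bounds

/-! ### Elementary estimates for the geometric factors -/

theorem sum_mul_pow_le_geomQuot {n : ℕ} (hn : 1 ≤ n) {β : ℝ} (h0 : 0 ≤ β) (h1 : β ≤ 1) :
    ∑ t : Fin n, (t : ℝ) * √β ^ (n - 1 - (t : ℕ)) ≤ ((n : ℝ) - 1) * geomQuot n β := by
  rw [Fin.sum_univ_eq_sum_range (fun t => (t : ℝ) * √β ^ (n - 1 - t)) n]
  unfold geomQuot
  obtain ⟨m, rfl⟩ : ∃ m, n = m + 1 := ⟨n - 1, by omega⟩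
  split_ifs with hβ
  · subst hβ
    have h := Finset.sum_range_id_mul_two (m + 1)
    have h' : (∑ i ∈ range (m + 1), (i : ℝ)) * 2 = (m + 1) * m := by
      have := congrArg (Nat.cast : ℕ → ℝ) h
      push_cast at this
      simpa using this
    simp
    linarith
  · set b := √β with hb
    have hb0 : 0 ≤ b := Real.sqrt_nonneg _
    have hb1 : b < 1 := by
      rw [hb, Real.sqrt_lt' one_pos]
      simpa using lt_of_le_of_ne h1 hβ
    have hpow : β ^ (((m + 1 : ℕ) : ℝ) / 4) = b ^ (((m + 1 : ℕ) : ℝ) / 2) := by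
      rw [hb, Real.sqrt_eq_rpow, ← Real.rpow_mul h0]
      congr 1; ring
    rw [hpow, mul_div_assoc', le_div_iff₀ (by linarith)]
    -- Multiplying by `1 - b` telescopes the weights, leaving a plain geometric sum.
    have hg : ∀ k : ℕ, (∑ t ∈ range (k + 1), (t : ℝ) * b ^ (k - t)) * (1 - b)
        = k - ∑ i ∈ range k, b ^ (i + 1) := by
      intro k
      induction k with
      | zero => simp
      | succ k ih =>
        have : ∑ t ∈ range (k + 1 + 1), (t : ℝ) * b ^ (k + 1 - t)
            = b * (∑ t ∈ range (k + 1), (t : ℝ) * b ^ (k - t)) + (k + 1) := by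
          rw [sum_range_succ, mul_sum]
          congr 1
          · refine sum_congr rfl fun t ht => ?_
            rw [Nat.sub_add_comm (Nat.lt_succ_iff.1 (mem_range.1 ht)), pow_succ]
            ring
          · simp
        rw [this, add_mul, mul_assoc, ih, sum_range_succ']
        have : ∑ i ∈ range k, b ^ (i + 1 + 1) = b * ∑ i ∈ range k, b ^ (i + 1) := by
          rw [mul_sum]; exact sum_congr rfl fun i _ => by ring
        rw [this]
        push_cast
        ring
    have hm := hg m
    simp only [Nat.add_sub_cancel]
    rw [hm]
    -- AM–GM on the terms with exponents `i + 1` and `m - i`, whose sum is always `m + 1 = n`.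
    have key : (m : ℝ) * b ^ (((m + 1 : ℕ) : ℝ) / 2) ≤ ∑ i ∈ range m, b ^ (i + 1) := by
      have hrefl : ∑ i ∈ range m, b ^ (m - i) = ∑ i ∈ range m, b ^ (i + 1) := by
        rw [← sum_range_reflect]
        refine sum_congr rfl fun i hi => ?_
        congr 1
        have := mem_range.1 hi
        omega
      have hterm : ∀ i ∈ range m, 2 * b ^ (((m + 1 : ℕ) : ℝ) / 2) ≤ b ^ (i + 1) + b ^ (m - i) := by
        intro i hi
        have hi' := mem_range.1 hi
        have hsq : (b ^ (((m + 1 : ℕ) : ℝ) / 2)) ^ 2 = b ^ (i + 1) * b ^ (m - i) := by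
          rw [← Real.rpow_natCast, ← Real.rpow_mul hb0, ← pow_add,
            show i + 1 + (m - i) = m + 1 by omega, ← Real.rpow_natCast b (m + 1)]
          congr 1; push_cast; ring
        refine abs_le_of_sq_le_sq' ?_ (by positivity) |>.2
        nlinarith [sq_nonneg (b ^ (i + 1) - b ^ (m - i))]
      have h := sum_le_sum hterm
      rw [sum_add_distrib, hrefl] at h
      simp at h
      push_cast
      linarith
    push_cast at key ⊢
    linarith

theorem geomQuot_le_minFactor {n : ℕ} (hn : 2 ≤ n) {β : ℝ} (h0 : 0 ≤ β) (h1 : β ≤ 1) :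
    geomQuot n β ≤ minFactor n β := by
  unfold geomQuot minFactor
  split_ifs with hβ
  · exact le_rfl
  · have hb0 : 0 ≤ √β := Real.sqrt_nonneg _
    have hb1 : √β < 1 := by
      rw [Real.sqrt_lt' one_pos]
      simpa using lt_of_le_of_ne h1 hβ
    have hn' : (2 : ℝ) ≤ n := by exact_mod_cast hn
    refine le_min ?_ ?_
    · have hpow : β ^ ((n : ℝ) / 4) = √β ^ ((n : ℝ) / 2) := by
        rw [Real.sqrt_eq_rpow, ← Real.rpow_mul h0]
        congr 1; ring
      -- Bernoulli's inequality; its exponent `n / 2` is at least 1 because `2 ≤ n`.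
      have h := one_add_mul_self_le_rpow_one_add (s := √β - 1) (by linarith)
        (p := (n : ℝ) / 2) (by linarith)
      rw [show 1 + (√β - 1) = √β by ring] at h
      rw [hpow, div_le_iff₀ (by linarith)]
      linarith
    · have : 0 ≤ β ^ ((n : ℝ) / 4) := Real.rpow_nonneg h0 _
      exact div_le_div_of_nonneg_right (by linarith) (by linarith)

/-! ### The permanent and the first inequality -/

variable {N n : ℕ}

theorem per_comp_perm (Z : Matrix (Fin N) (Fin n) ℂ) (τ : Equiv.Perm (Fin n)) :
    per (fun i r => Z i (τ r)) = per Z := by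
  unfold per
  rw [← (Equiv.embeddingCongr τ.symm (Equiv.refl (Fin N))).sum_comp]
  refine sum_congr rfl fun j _ => ?_
  simpa using Equiv.prod_comp τ (fun r => Z (j r) r)

theorem factorial_div_mul_per (hnN : n ≤ N) (Z : Matrix (Fin N) (Fin n) ℂ) :
    (((N - n).factorial : ℂ) / (N.factorial : ℂ)) * per Z
      = (∑ σ : Equiv.Perm (Fin N), ∏ r : Fin n, Z (σ (Fin.castLEEmb hnN r)) r)
        / ((Fintype.card (Fin N)).factorial : ℂ) := by
  have h := card_mul_sum_perm_comp_embedding (Fin.castLEEmb hnN)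
    (fun j => ∏ r : Fin n, Z (j r) r)
  rw [Fintype.card_embedding_eq, Fintype.card_fin, Fintype.card_fin] at h
  have h2 : (N.factorial : ℂ) = ((N - n).factorial : ℂ) * (N.descFactorial n : ℂ) := by
    exact_mod_cast (Nat.factorial_mul_descFactorial hnN).symm
  have hN : (N.factorial : ℂ) ≠ 0 := by exact_mod_cast N.factorial_ne_zero
  have hd : (N.descFactorial n : ℂ) ≠ 0 := fun h0 => hN (by rw [h2, h0, mul_zero])
  rw [Fintype.card_fin, div_mul_eq_mul_div]
  congr 1
  apply mul_left_cancel₀ hd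
  rw [← mul_assoc, mul_comm (N.descFactorial n : ℂ), ← h2]
  exact h.symm

/-- The mean over ordered pairs of distinct rows of the product of the absolute differences in
columns `r` and `s`. -/
noncomputable def meanAbsDiffMul (Z : Matrix (Fin N) (Fin n) ℂ) (r s : Fin n) : ℝ :=
  (∑ q : Fin N × Fin N with q.1 ≠ q.2, ‖Z q.1 r - Z q.2 r‖ * ‖Z q.1 s - Z q.2 s‖)
    / ((N : ℝ) * ((N : ℝ) - 1))

theorem colMean_eq_div (Z : Matrix (Fin N) (Fin n) ℂ) (r : Fin n) :
    colMean Z r = (∑ j, Z j r) / (N : ℂ) := by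
  rw [colMean, one_div_mul_eq_div]

theorem theta_eq_sqrt (hN : 2 ≤ N) (hn : 2 ≤ n) (Z : Matrix (Fin N) (Fin n) ℂ) :
    theta Z = √((∑ p : Fin n × Fin n with p.1 ≠ p.2, meanAbsDiffMul Z p.1 p.2 ^ 2)
      / ((n : ℝ) * ((n : ℝ) - 1))) := by
  have hN' : (2 : ℝ) ≤ N := by exact_mod_cast hN
  have hn' : (2 : ℝ) ≤ n := by exact_mod_cast hn
  have hp : (0 : ℝ) < (N : ℝ) * ((N : ℝ) - 1) := mul_pos (by linarith) (by linarith)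
  have hq : (0 : ℝ) < (n : ℝ) * ((n : ℝ) - 1) := mul_pos (by linarith) (by linarith)
  unfold theta meanAbsDiffMul
  simp only [div_pow]
  rw [← sum_div, Real.sqrt_div' _ hq.le, Real.sqrt_div' _ (by positivity), Real.sqrt_sq hp.le]
  field_simp

theorem norm_per_sub_prod_le_of_perm (hN : 2 ≤ N) (hnN : n ≤ N) (Z : Matrix (Fin N) (Fin n) ℂ)
    (hZ : ∀ j r, ‖Z j r‖ ≤ 1) (τ : Equiv.Perm (Fin n)) :
    ‖(((N - n).factorial : ℂ) / (N.factorial : ℂ)) * per Z - ∏ r : Fin n, colMean Z r‖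
      ≤ ∑ t : Fin n, ∑ r ∈ Iio t, meanAbsDiffMul Z (τ r) (τ t)
          * (∏ q ∈ Ioi t, ‖colMean Z (τ q)‖) / (2 * (N : ℝ)) := by
  have h := norm_permMean_sub_prod_le (Fin.castLEEmb hnN) (fun i r => Z i (τ r))
    (fun i r => hZ i _) univ (by simpa using hN)
  have h2 := factorial_div_mul_per hnN (fun i r => Z i (τ r))
  rw [per_comp_perm] at h2
  rw [h2, ← Equiv.prod_comp τ]
  simp only [Fintype.card_fin] at h ⊢
  simp only [colMean_eq_div]
  refine h.trans (le_of_eq ?_)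
  refine sum_congr rfl fun t _ => ?_
  rw [show univ.filter (· < t) = Iio t by ext; simp, show univ.filter (t < ·) = Ioi t by ext; simp,
    sum_mul]
  refine sum_congr rfl fun r _ => ?_
  unfold meanAbsDiffMul
  ring

theorem beta_eq_div (Z : Matrix (Fin N) (Fin n) ℂ) :
    beta Z = (∑ r, ‖colMean Z r‖ ^ 2) / n := by
  rw [beta, one_div_mul_eq_div]

theorem beta_nonneg (Z : Matrix (Fin N) (Fin n) ℂ) : 0 ≤ beta Z := by
  rw [beta_eq_div]; positivity

theorem norm_colMean_le_one (Z : Matrix (Fin N) (Fin n) ℂ) (hZ : ∀ j r, ‖Z j r‖ ≤ 1)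
    (r : Fin n) : ‖colMean Z r‖ ≤ 1 := by
  rw [colMean_eq_div, norm_div, Complex.norm_natCast]
  refine div_le_one_of_le₀ ?_ (Nat.cast_nonneg _)
  exact (norm_sum_le _ _).trans ((sum_le_sum fun j _ => hZ j r).trans_eq (by simp))

theorem beta_le_one (Z : Matrix (Fin N) (Fin n) ℂ) (hZ : ∀ j r, ‖Z j r‖ ≤ 1) : beta Z ≤ 1 := by
  rw [beta_eq_div]
  refine div_le_one_of_le₀ ?_ (Nat.cast_nonneg _)
  exact (sum_le_sum fun r _ => pow_le_one₀ (norm_nonneg _) (norm_colMean_le_one Z hZ r)).trans_eq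
    (by simp)

theorem theta_nonneg (hN : 2 ≤ N) (hn : 2 ≤ n) (Z : Matrix (Fin N) (Fin n) ℂ) : 0 ≤ theta Z := by
  rw [theta_eq_sqrt hN hn]; positivity

theorem norm_per_sub_prod_le (hn : 2 ≤ n) (hnN : n ≤ N) (Z : Matrix (Fin N) (Fin n) ℂ)
    (hZ : ∀ j r, ‖Z j r‖ ≤ 1) :
    ‖(((N - n).factorial : ℂ) / (N.factorial : ℂ)) * per Z - ∏ r : Fin n, colMean Z r‖
      ≤ (((n : ℝ) - 1) / (2 * (N : ℝ))) * theta Z * geomQuot n (beta Z) := by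
  have hN : 2 ≤ N := hn.trans hnN
  have hf : (0 : ℝ) < (n.factorial : ℝ) := by exact_mod_cast n.factorial_pos
  set X := ‖(((N - n).factorial : ℂ) / (N.factorial : ℂ)) * per Z - ∏ r : Fin n, colMean Z r‖
  -- The left side is independent of `τ`, so the bound is summed over all column orders.
  have h1 : (n.factorial : ℝ) * X ≤ ∑ τ : Equiv.Perm (Fin n), ∑ t : Fin n, ∑ r ∈ Iio t,
      meanAbsDiffMul Z (τ r) (τ t) * (∏ q ∈ Ioi t, ‖colMean Z (τ q)‖) / (2 * (N : ℝ)) := by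
    have := sum_le_sum fun (τ : Equiv.Perm (Fin n)) (_ : τ ∈ univ) =>
      norm_per_sub_prod_le_of_perm hN hnN Z hZ τ
    simpa [Fintype.card_perm] using this
  have h2 : ∑ τ : Equiv.Perm (Fin n), ∑ t : Fin n, ∑ r ∈ Iio t,
      meanAbsDiffMul Z (τ r) (τ t) * (∏ q ∈ Ioi t, ‖colMean Z (τ q)‖) / (2 * (N : ℝ))
      ≤ ∑ t : Fin n, ∑ r ∈ Iio t,
        (n.factorial : ℝ) * (theta Z * √(beta Z) ^ (n - 1 - (t : ℕ))) / (2 * (N : ℝ)) := by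
    rw [sum_comm]
    refine sum_le_sum fun t _ => ?_
    rw [sum_comm]
    refine sum_le_sum fun r hr => ?_
    rw [← sum_div]
    refine div_le_div_of_nonneg_right ?_ (by positivity)
    have h := sum_perm_mul_prod_le (mem_Iio.1 hr).ne (meanAbsDiffMul Z)
      (fun q => ‖colMean Z q‖) (Ioi t)
    rw [theta_eq_sqrt hN hn, beta_eq_div]
    simpa [Fin.card_Ioi] using h
  have h3 : ∑ t : Fin n, ∑ r ∈ Iio t,
        (n.factorial : ℝ) * (theta Z * √(beta Z) ^ (n - 1 - (t : ℕ))) / (2 * (N : ℝ))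
      = (n.factorial : ℝ) * (theta Z / (2 * (N : ℝ))
        * ∑ t : Fin n, (t : ℝ) * √(beta Z) ^ (n - 1 - (t : ℕ))) := by
    simp only [sum_const, Fin.card_Iio, nsmul_eq_mul]
    rw [mul_sum, mul_sum]
    exact sum_congr rfl fun t _ => by ring
  have h4 := le_of_mul_le_mul_left (h1.trans (h2.trans_eq h3)) hf
  refine h4.trans ?_
  have hθ : 0 ≤ theta Z / (2 * (N : ℝ)) := div_nonneg (theta_nonneg hN hn Z) (by positivity)
  refine (mul_le_mul_of_nonneg_left (sum_mul_pow_le_geomQuot (by omega) (beta_nonneg Z)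
    (beta_le_one Z hZ)) hθ).trans_eq ?_
  ring

/-! ### Column variances and the last two inequalities -/

theorem sum_norm_sub_colMean_sq (hN : N ≠ 0) (Z : Matrix (Fin N) (Fin n) ℂ) (r : Fin n) :
    ∑ j, ‖Z j r - colMean Z r‖ ^ 2 = ∑ j, ‖Z j r‖ ^ 2 - N * ‖colMean Z r‖ ^ 2 := by
  have hc : (N : ℂ) ≠ 0 := by exact_mod_cast hN
  have hs : ∑ j, Z j r = N * colMean Z r := by
    rw [colMean_eq_div, mul_div_cancel₀ _ hc]
  have hre : ∑ j, (Z j r).re = N * (colMean Z r).re := by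
    have := congrArg Complex.re hs
    simpa using this
  have him : ∑ j, (Z j r).im = N * (colMean Z r).im := by
    have := congrArg Complex.im hs
    simpa using this
  have h : ∀ j, ‖Z j r - colMean Z r‖ ^ 2 = ‖Z j r‖ ^ 2 + ‖colMean Z r‖ ^ 2
      - 2 * ((Z j r).re * (colMean Z r).re) - 2 * ((Z j r).im * (colMean Z r).im) := by
    intro j
    simp only [← Complex.normSq_eq_norm_sq, Complex.normSq_apply, Complex.sub_re, Complex.sub_im]
    ring
  simp only [h, sum_sub_distrib, sum_add_distrib, ← mul_sum, ← sum_mul, hre, him]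
  simp only [← Complex.normSq_eq_norm_sq, Complex.normSq_apply]
  simp
  ring

theorem sum_norm_sub_sq (hN : N ≠ 0) (Z : Matrix (Fin N) (Fin n) ℂ) (r : Fin n) :
    ∑ q : Fin N × Fin N, ‖Z q.1 r - Z q.2 r‖ ^ 2
      = 2 * N * ∑ j, ‖Z j r - colMean Z r‖ ^ 2 := by
  have hc : (N : ℂ) ≠ 0 := by exact_mod_cast hN
  have hs : ∑ j, Z j r = N * colMean Z r := by
    rw [colMean_eq_div, mul_div_cancel₀ _ hc]
  have hre : ∑ j, (Z j r).re = N * (colMean Z r).re := by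
    have := congrArg Complex.re hs
    simpa using this
  have him : ∑ j, (Z j r).im = N * (colMean Z r).im := by
    have := congrArg Complex.im hs
    simpa using this
  have h : ∀ j k, ‖Z j r - Z k r‖ ^ 2 = ‖Z j r‖ ^ 2 + ‖Z k r‖ ^ 2
      - 2 * ((Z j r).re * (Z k r).re) - 2 * ((Z j r).im * (Z k r).im) := by
    intro j k
    simp only [← Complex.normSq_eq_norm_sq, Complex.normSq_apply, Complex.sub_re, Complex.sub_im]
    ring
  rw [sum_norm_sub_colMean_sq hN, Fintype.sum_prod_type]
  simp only [h, sum_sub_distrib, sum_add_distrib, ← mul_sum, ← sum_mul, hre, him, sum_const, card_univ,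
    Fintype.card_fin, nsmul_eq_mul]
  rw [← Complex.normSq_eq_norm_sq (colMean Z r), Complex.normSq_apply]
  ring

theorem alpha_eq_div (Z : Matrix (Fin N) (Fin n) ℂ) :
    alpha Z = (∑ r, ∑ j, ‖Z j r - colMean Z r‖ ^ 2) / (n * N) := by
  rw [alpha, one_div_mul_eq_div]

theorem alpha_nonneg (Z : Matrix (Fin N) (Fin n) ℂ) : 0 ≤ alpha Z := by
  rw [alpha_eq_div]; positivity

/-- By the variance identity, `α + β` is the mean of `|z|²` over all entries. -/
theorem alpha_le_one_sub_beta (hN : N ≠ 0) (hn : n ≠ 0) (Z : Matrix (Fin N) (Fin n) ℂ)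
    (hZ : ∀ j r, ‖Z j r‖ ≤ 1) : alpha Z ≤ 1 - beta Z := by
  have hN' : (0 : ℝ) < N := by exact_mod_cast Nat.pos_of_ne_zero hN
  have hn' : (0 : ℝ) < n := by exact_mod_cast Nat.pos_of_ne_zero hn
  rw [alpha_eq_div, beta_eq_div, div_le_iff₀ (by positivity)]
  have h : ∀ r : Fin n, ∑ j, ‖Z j r - colMean Z r‖ ^ 2 ≤ N - N * ‖colMean Z r‖ ^ 2 := by
    intro r
    rw [sum_norm_sub_colMean_sq hN]
    have : ∑ j, ‖Z j r‖ ^ 2 ≤ N :=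
      (sum_le_sum fun j _ => pow_le_one₀ (norm_nonneg _) (hZ j r)).trans_eq (by simp)
    linarith
  refine (sum_le_sum fun r _ => h r).trans_eq ?_
  rw [sum_sub_distrib, ← mul_sum]
  simp
  field_simp

theorem meanAbsDiffMul_sq_le (hN : 2 ≤ N) (Z : Matrix (Fin N) (Fin n) ℂ) (r s : Fin n) :
    meanAbsDiffMul Z r s ^ 2 ≤ (2 / ((N : ℝ) - 1)) ^ 2
      * ((∑ j, ‖Z j r - colMean Z r‖ ^ 2) * ∑ j, ‖Z j s - colMean Z s‖ ^ 2) := by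
  have hN' : (2 : ℝ) ≤ N := by exact_mod_cast hN
  have hN1 : (0 : ℝ) < (N : ℝ) - 1 := by linarith
  have hp : (0 : ℝ) < (N : ℝ) * ((N : ℝ) - 1) := mul_pos (by linarith) (by linarith)
  unfold meanAbsDiffMul
  rw [div_pow, div_le_iff₀ (by positivity)]
  have h1 : ∑ q : Fin N × Fin N with q.1 ≠ q.2, ‖Z q.1 r - Z q.2 r‖ * ‖Z q.1 s - Z q.2 s‖
      ≤ ∑ q : Fin N × Fin N, ‖Z q.1 r - Z q.2 r‖ * ‖Z q.1 s - Z q.2 s‖ :=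
    sum_le_sum_of_subset_of_nonneg (filter_subset _ _) fun _ _ _ => by positivity
  have h2 := pow_le_pow_left₀ (sum_nonneg fun _ _ => by positivity) h1 2
  refine h2.trans ((sum_mul_sq_le_sq_mul_sq _ _ _).trans_eq ?_)
  rw [sum_norm_sub_sq (by omega), sum_norm_sub_sq (by omega)]
  field_simp

/-- Removing the diagonal from `(∑ V)²` costs `∑ V²`, which is at least `(∑ V)² / n`. This saving
matches the normalisation `√(n(n-1))` in `ϑ`. -/
theorem sum_offDiag_mul_le (V : Fin n → ℝ) :
    (n : ℝ) * ∑ p : Fin n × Fin n with p.1 ≠ p.2, V p.1 * V p.2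
      ≤ ((n : ℝ) - 1) * (∑ r, V r) ^ 2 := by
  have h1 : ∑ p : Fin n × Fin n with p.1 ≠ p.2, V p.1 * V p.2
      = (∑ r, V r) ^ 2 - ∑ r, V r ^ 2 := by
    have h := sum_filter_add_sum_filter_not (univ : Finset (Fin n × Fin n))
      (fun p => p.1 = p.2) (fun p => V p.1 * V p.2)
    have hd : ∑ p : Fin n × Fin n with p.1 = p.2, V p.1 * V p.2 = ∑ r, V r ^ 2 := by
      rw [sum_filter, Fintype.sum_prod_type]
      simp [sq]
    rw [hd, Fintype.sum_prod_type, ← Fintype.sum_mul_sum, ← sq] at h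
    linarith
  have h2 := sq_sum_le_card_mul_sum_sq (s := (univ : Finset (Fin n))) (f := V)
  rw [card_univ, Fintype.card_fin] at h2
  rw [h1]
  linarith

theorem theta_le (hN : 2 ≤ N) (hn : 2 ≤ n) (Z : Matrix (Fin N) (Fin n) ℂ) :
    theta Z ≤ 2 * N * alpha Z / ((N : ℝ) - 1) := by
  have hN' : (2 : ℝ) ≤ N := by exact_mod_cast hN
  have hn' : (2 : ℝ) ≤ n := by exact_mod_cast hn
  have hN1 : (0 : ℝ) < (N : ℝ) - 1 := by linarith
  have hn1 : (0 : ℝ) < (n : ℝ) - 1 := by linarith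
  have hα := alpha_nonneg Z
  rw [theta_eq_sqrt hN hn]
  refine Real.sqrt_le_iff.2 ⟨by positivity, ?_⟩
  set V : Fin n → ℝ := fun r => ∑ j, ‖Z j r - colMean Z r‖ ^ 2
  have h1 : ∑ p : Fin n × Fin n with p.1 ≠ p.2, meanAbsDiffMul Z p.1 p.2 ^ 2
      ≤ (2 / ((N : ℝ) - 1)) ^ 2 * ∑ p : Fin n × Fin n with p.1 ≠ p.2, V p.1 * V p.2 := by
    rw [mul_sum]
    exact sum_le_sum fun p _ => meanAbsDiffMul_sq_le hN Z p.1 p.2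
  have h2 := sum_offDiag_mul_le V
  have hV : ∑ r, V r = n * N * alpha Z := by
    rw [alpha_eq_div, mul_div_cancel₀ _ (by positivity)]
  rw [hV] at h2
  have h3 : ∑ p : Fin n × Fin n with p.1 ≠ p.2, V p.1 * V p.2
      ≤ ((n : ℝ) - 1) * n * (N * alpha Z) ^ 2 := by
    refine le_of_mul_le_mul_left (h2.trans_eq ?_) (show (0 : ℝ) < n by linarith)
    ring
  rw [div_le_iff₀ (by positivity)]
  refine h1.trans ((mul_le_mul_of_nonneg_left h3 (by positivity)).trans_eq ?_)
  field_simp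

theorem mul_theta_mul_geomQuot_le (hn : 2 ≤ n) (hnN : n ≤ N) (Z : Matrix (Fin N) (Fin n) ℂ)
    (hZ : ∀ j r, ‖Z j r‖ ≤ 1) :
    (((n : ℝ) - 1) / (2 * (N : ℝ))) * theta Z * geomQuot n (beta Z)
      ≤ (((n : ℝ) - 1) / ((N : ℝ) - 1)) * alpha Z * minFactor n (beta Z) := by
  have hN : 2 ≤ N := hn.trans hnN
  have hN' : (2 : ℝ) ≤ N := by exact_mod_cast hN
  have hn' : (2 : ℝ) ≤ n := by exact_mod_cast hn
  have hN1 : (0 : ℝ) < (N : ℝ) - 1 := by linarith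
  have hn1 : (0 : ℝ) < (n : ℝ) - 1 := by linarith
  have h0 : 0 ≤ geomQuot n (beta Z) := by
    have h := sum_mul_pow_le_geomQuot (n := n) (by omega) (beta_nonneg Z) (beta_le_one Z hZ)
    exact nonneg_of_mul_nonneg_right ((sum_nonneg fun t _ => by positivity).trans h) hn1
  have hα := alpha_nonneg Z
  have h1 : (((n : ℝ) - 1) / (2 * (N : ℝ))) * theta Z
      ≤ (((n : ℝ) - 1) / ((N : ℝ) - 1)) * alpha Z := by
    refine (mul_le_mul_of_nonneg_left (theta_le hN hn Z) (by positivity)).trans_eq ?_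
    field_simp
  exact mul_le_mul h1 (geomQuot_le_minFactor hn (beta_nonneg Z) (beta_le_one Z hZ)) h0
    (by positivity)

theorem mul_alpha_mul_minFactor_le (hn : 2 ≤ n) (hnN : n ≤ N) (Z : Matrix (Fin N) (Fin n) ℂ)
    (hZ : ∀ j r, ‖Z j r‖ ≤ 1) :
    (((n : ℝ) - 1) / ((N : ℝ) - 1)) * alpha Z * minFactor n (beta Z)
      ≤ (1 + √(beta Z)) * (((n : ℝ) - 1) / ((N : ℝ) - 1)) := by
  have hN : 2 ≤ N := hn.trans hnN
  have hN' : (2 : ℝ) ≤ N := by exact_mod_cast hN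
  have hn' : (2 : ℝ) ≤ n := by exact_mod_cast hn
  have hc : 0 ≤ ((n : ℝ) - 1) / ((N : ℝ) - 1) := div_nonneg (by linarith) (by linarith)
  have hα := alpha_nonneg Z
  have hαβ := alpha_le_one_sub_beta (by omega) (by omega) Z hZ
  have hβ0 := beta_nonneg Z
  have hβ1 := beta_le_one Z hZ
  rw [mul_assoc, mul_comm (1 + _)]
  refine mul_le_mul_of_nonneg_left ?_ hc
  unfold minFactor
  split_ifs with h
  -- If `β = 1`, then `0 ≤ α ≤ 1 - β` forces `α = 0`.
  · rw [show alpha Z = 0 by linarith, zero_mul]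
    positivity
  · have hb1 : √(beta Z) < 1 := by
      rw [Real.sqrt_lt' one_pos]
      simpa using lt_of_le_of_ne hβ1 h
    refine (mul_le_mul_of_nonneg_left (min_le_right _ _) hα).trans ?_
    rw [mul_one_div, div_le_iff₀ (by linarith)]
    refine hαβ.trans_eq ?_
    have := Real.mul_self_sqrt hβ0
    linarith

end RectPerm

theorem mainTheorem7 (N n : ℕ) (hn : 2 ≤ n) (hnN : n ≤ N)
    (Z : Matrix (Fin N) (Fin n) ℂ) (hZ : ∀ (j : Fin N) (r : Fin n), ‖Z j r‖ ≤ 1) :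
    ‖(((N - n).factorial : ℂ) / (N.factorial : ℂ)) * RectPerm.per Z
        - ∏ r : Fin n, RectPerm.colMean Z r‖
      ≤ (((n : ℝ) - 1) / (2 * (N : ℝ))) * RectPerm.theta Z
          * RectPerm.geomQuot n (RectPerm.beta Z) ∧
    (((n : ℝ) - 1) / (2 * (N : ℝ))) * RectPerm.theta Z
          * RectPerm.geomQuot n (RectPerm.beta Z)
      ≤ (((n : ℝ) - 1) / ((N : ℝ) - 1)) * RectPerm.alpha Z
          * RectPerm.minFactor n (RectPerm.beta Z) ∧
    (((n : ℝ) - 1) / ((N : ℝ) - 1)) * RectPerm.alpha Z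
          * RectPerm.minFactor n (RectPerm.beta Z)
      ≤ (1 + √(RectPerm.beta Z)) * (((n : ℝ) - 1) / ((N : ℝ) - 1)) :=
  ⟨RectPerm.norm_per_sub_prod_le hn hnN Z hZ, RectPerm.mul_theta_mul_geomQuot_le hn hnN Z hZ,
    RectPerm.mul_alpha_mul_minFactor_le hn hnN Z hZ⟩
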